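/- Let $T$ be the right shift $Te_n=e_{n+1}$ on $\ell^2(\mathbb{Z}_+)$ with standard orthonormal basis $(e_n)_{n\ge 0}$, let $\mathcal{T}\subseteq B(\ell^2(\mathbb{Z}_+))$ be the Toeplitz algebra, that is, the norm closed subalgebra generated by $T$ and $T^*$, and put $T_{n,m}=T^n(T^*)^m$. Let $\mathcal{T}\otimes\mathcal{T}\subseteq B(\ell^2(\mathbb{Z}_+)\otimes\ell^2(\mathbb{Z}_+))$ be the minimal $C^*$-tensor product, and let $\Delta\colon\mathcal{T}\to\mathcal{T}\otimes\mathcal{T}$ be the unique unital $*$-homomorphism with $\Delta(T)=T\otimes T$. A compact quantum group in the sense of Woronowicz is a pair $(\mathcal{A},\Delta)$ of a unital $C^*$-algebra $\mathcal{A}$ and a unital $*$-homomorphism $\Delta\colon\mathcal{A}\to\mathcal{A}\otimes\mathcal{A}$ (minimal tensor product) with $(\Delta\otimes\mathrm{id})\Delta=(\mathrm{id}\otimes\Delta)\Delta$, such that the linear spans of $\{(a\otimes I)\Delta(b): a,b\in\mathcal{A}\}$ and of $\{(I\otimes a)\Delta(b): a,b\in\mathcal{A}\}$ are both dense in $\mathcal{A}\otimes\mathcal{A}$.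 Theorem. $(\mathcal{T},\Delta)$ is not a compact quantum group. More precisely, let $\mathcal{L}$ be the linear span of $\{(a\otimes I)\Delta(b): a,b\in\mathcal{T}\}$. Then $\mathcal{L}$ is not dense in $\mathcal{T}\otimes\mathcal{T}$: the element $T_{1,0}\otimes T_{0,1}$ is not in the norm closure of $\mathcal{L}$, and moreover the vector $(T_{1,0}\otimes T_{0,1})(e_0\otimes e_1)$ is not in the closure of $\{B(e_0\otimes e_1): B\in\mathcal{L}\}$ in $\ell^2(\mathbb{Z}_+)\otimes\ell^2(\mathbb{Z}_+)$. -/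

import Mathlib

open scoped TensorProduct InnerProductSpace

noncomputable section

namespace ToeplitzCQS

universe u v w

/-! ### Hilbert space tensor products and tensor products of operators -/

/-- The tensor product of Hilbert spaces: the completion of the algebraic tensor product for the
inner product `⟪x ⊗ y, x' ⊗ y'⟫ = ⟪x, x'⟫ * ⟪y, y'⟫`. -/
def HilbertTensor (H : Type u) (K : Type v)
    [NormedAddCommGroup H] [InnerProductSpace ℂ H]
    [NormedAddCommGroup K] [InnerProductSpace ℂ K] : Type (max u v) :=
  UniformSpace.Completion (H ⊗[ℂ] K)

section General

variable {H : Type u} {K : Type v} {L : Type w}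
  [NormedAddCommGroup H] [InnerProductSpace ℂ H]
  [NormedAddCommGroup K] [InnerProductSpace ℂ K]
  [NormedAddCommGroup L] [InnerProductSpace ℂ L]

instance : NormedAddCommGroup (HilbertTensor H K) :=
  inferInstanceAs (NormedAddCommGroup (UniformSpace.Completion (H ⊗[ℂ] K)))

instance : InnerProductSpace ℂ (HilbertTensor H K) :=
  inferInstanceAs (InnerProductSpace ℂ (UniformSpace.Completion (H ⊗[ℂ] K)))

instance : CompleteSpace (HilbertTensor H K) :=
  inferInstanceAs (CompleteSpace (UniformSpace.Completion (H ⊗[ℂ] K)))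

variable (H K) in
/-- The canonical isometric embedding of the algebraic tensor product. -/
def toHilbertTensor : H ⊗[ℂ] K →ₗᵢ[ℂ] HilbertTensor H K where
  toFun z := (z : UniformSpace.Completion (H ⊗[ℂ] K))
  map_add' x y := UniformSpace.Completion.coe_add x y
  map_smul' c x := UniformSpace.Completion.coe_smul c x
  norm_map' x := UniformSpace.Completion.norm_coe x

theorem denseRange_toHilbertTensor : DenseRange (toHilbertTensor H K) :=
  UniformSpace.Completion.denseRange_coe

/-- The elementary tensor `x ⊗ y` of two vectors in the Hilbert space tensor product. -/
def vecTensor (x : H) (y : K) : HilbertTensor H K := toHilbertTensor H K (x ⊗ₜ[ℂ] y)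

/-- Two bounded operators on a Hilbert space tensor product agreeing on elementary tensors are
equal. -/
theorem hilbertTensor_ext {F : Type w} [NormedAddCommGroup F] [NormedSpace ℂ F]
    {f g : HilbertTensor H K →L[ℂ] F}
    (h : ∀ x y, f (vecTensor x y) = g (vecTensor x y)) : f = g := by
  refine ContinuousLinearMap.coeFn_injective
    (denseRange_toHilbertTensor.equalizer f.continuous g.continuous ?_)
  funext z
  induction z using TensorProduct.induction_on with
  | zero => simp
  | tmul x y => exact h x y
  | add a b ha hb =>
    simp only [Function.comp_apply] at ha hb ⊢
    rw [map_add, map_add, map_add, ha, hb]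

/-- The tensor product `a ⊗ b` of two bounded operators, acting on the Hilbert space tensor
product: the continuous extension of the algebraic tensor product of the two maps. -/
def opTensor (a : H →L[ℂ] H) (b : K →L[ℂ] K) : HilbertTensor H K →L[ℂ] HilbertTensor H K :=
  ((toHilbertTensor H K).toContinuousLinearMap.comp (TensorProduct.mapL a b)).extend
    (toHilbertTensor H K).toContinuousLinearMap

@[simp]
theorem opTensor_vecTensor (a : H →L[ℂ] H) (b : K →L[ℂ] K) (x : H) (y : K) :
    opTensor a b (vecTensor x y) = vecTensor (a x) (b y) := by
  have h := ContinuousLinearMap.extend_eq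
    ((toHilbertTensor H K).toContinuousLinearMap.comp (TensorProduct.mapL a b))
    (e := (toHilbertTensor H K).toContinuousLinearMap) denseRange_toHilbertTensor
    (toHilbertTensor H K).isometry.isUniformInducing (x ⊗ₜ[ℂ] y)
  exact h

@[simp]
theorem inner_vecTensor (x x' : H) (y y' : K) :
    ⟪vecTensor x y, vecTensor x' y'⟫_ℂ = ⟪x, x'⟫_ℂ * ⟪y, y'⟫_ℂ := by
  simp [vecTensor, LinearIsometry.inner_map_map]

theorem continuous_vecTensor : Continuous fun p : H × K => vecTensor p.1 p.2 :=
  (toHilbertTensor H K).continuous.comp TensorProduct.continuous_tmul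

theorem vecTensor_add_left (x x' : H) (y : K) :
    vecTensor (x + x') y = vecTensor x y + vecTensor x' y := by
  simp [vecTensor, TensorProduct.add_tmul]

theorem vecTensor_smul_left (c : ℂ) (x : H) (y : K) :
    vecTensor (c • x) y = c • vecTensor x y := by
  simp [vecTensor, ← TensorProduct.smul_tmul']

theorem vecTensor_add_right (x : H) (y y' : K) :
    vecTensor x (y + y') = vecTensor x y + vecTensor x y' := by
  simp [vecTensor, TensorProduct.tmul_add]

theorem vecTensor_smul_right (c : ℂ) (x : H) (y : K) :
    vecTensor x (c • y) = c • vecTensor x y := by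
  simp [vecTensor]

theorem opTensor_one : opTensor (1 : H →L[ℂ] H) (1 : K →L[ℂ] K) = 1 :=
  hilbertTensor_ext fun x y => by simp

theorem opTensor_mul (a a' : H →L[ℂ] H) (b b' : K →L[ℂ] K) :
    opTensor (a * a') (b * b') = opTensor a b * opTensor a' b' :=
  hilbertTensor_ext fun x y => by simp

theorem opTensor_add_left (a a' : H →L[ℂ] H) (b : K →L[ℂ] K) :
    opTensor (a + a') b = opTensor a b + opTensor a' b :=
  hilbertTensor_ext fun x y => by simp [vecTensor_add_left]

theorem opTensor_smul_left (c : ℂ) (a : H →L[ℂ] H) (b : K →L[ℂ] K) :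
    opTensor (c • a) b = c • opTensor a b :=
  hilbertTensor_ext fun x y => by simp [vecTensor_smul_left]

theorem span_vecTensor_dense {s : Set H} {t : Set K}
    (hs : ⊤ ≤ (Submodule.span ℂ s).topologicalClosure)
    (ht : ⊤ ≤ (Submodule.span ℂ t).topologicalClosure) :
    ⊤ ≤ (Submodule.span ℂ {z : HilbertTensor H K | ∃ x ∈ s, ∃ y ∈ t, z = vecTensor x y}).topologicalClosure := by
  set S := (Submodule.span ℂ
    {z : HilbertTensor H K | ∃ x ∈ s, ∃ y ∈ t, z = vecTensor x y}).topologicalClosure with hS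
  have hcl : IsClosed (S : Set (HilbertTensor H K)) := Submodule.isClosed_topologicalClosure _
  have h1 : ∀ x ∈ s, ∀ y ∈ Submodule.span ℂ t, vecTensor x y ∈ S := by
    intro x hx y hy
    induction hy using Submodule.span_induction with
    | mem y hy => exact Submodule.le_topologicalClosure _ (Submodule.subset_span ⟨x, hx, y, hy, rfl⟩)
    | zero =>
      have : vecTensor x (0 : K) = 0 := by simp [vecTensor]
      rw [this]; exact S.zero_mem
    | add a b _ _ ha hb => rw [vecTensor_add_right]; exact S.add_mem ha hb
    | smul c a _ ha => rw [vecTensor_smul_right]; exact S.smul_mem c ha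
  have h2 : ∀ x ∈ s, ∀ y : K, vecTensor x y ∈ S := by
    intro x hx y
    have hc : Continuous fun y : K => vecTensor x y :=
      continuous_vecTensor.comp (Continuous.prodMk_right x)
    have hy : y ∈ closure (Submodule.span ℂ t : Set K) := ht trivial
    exact closure_minimal (fun y hy => h1 x hx y hy) (hcl.preimage hc) hy
  have h3 : ∀ x ∈ Submodule.span ℂ s, ∀ y : K, vecTensor x y ∈ S := by
    intro x hx y
    induction hx using Submodule.span_induction with
    | mem x hx => exact h2 x hx y
    | zero =>
      have : vecTensor (0 : H) y = 0 := by simp [vecTensor]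
      rw [this]; exact S.zero_mem
    | add a b _ _ ha hb => rw [vecTensor_add_left]; exact S.add_mem ha hb
    | smul c a _ ha => rw [vecTensor_smul_left]; exact S.smul_mem c ha
  have h4 : ∀ (x : H) (y : K), vecTensor x y ∈ S := by
    intro x y
    have hc : Continuous fun x : H => vecTensor x y :=
      continuous_vecTensor.comp (Continuous.prodMk_left y)
    have hx : x ∈ closure (Submodule.span ℂ s : Set H) := hs trivial
    exact closure_minimal (fun x hx => h3 x hx y) (hcl.preimage hc) hx
  intro z _
  refine closure_minimal ?_ hcl (denseRange_toHilbertTensor z)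
  rintro _ ⟨z, rfl⟩
  induction z using TensorProduct.induction_on with
  | zero => rw [map_zero]; exact S.zero_mem
  | tmul x y => exact h4 x y
  | add a b ha hb => rw [map_add]; exact S.add_mem ha hb

/-- The canonical map of the algebraic `(H ⊗ K) ⊗ L` into the Hilbert space `(H ⊗ K) ⊗ L`. -/
def tripleLeft : (H ⊗[ℂ] K) ⊗[ℂ] L →ₗᵢ[ℂ] HilbertTensor (HilbertTensor H K) L :=
  (toHilbertTensor (HilbertTensor H K) L).comp ((toHilbertTensor H K).rTensor L)

/-- The canonical map of the algebraic `H ⊗ (K ⊗ L)` into the Hilbert space `H ⊗ (K ⊗ L)`. -/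
def tripleRight : H ⊗[ℂ] (K ⊗[ℂ] L) →ₗᵢ[ℂ] HilbertTensor H (HilbertTensor K L) :=
  (toHilbertTensor H (HilbertTensor K L)).comp ((toHilbertTensor K L).lTensor H)

theorem denseRange_tripleLeft :
    DenseRange (tripleLeft : (H ⊗[ℂ] K) ⊗[ℂ] L →ₗᵢ[ℂ] HilbertTensor (HilbertTensor H K) L) := by
  have h := span_vecTensor_dense (H := HilbertTensor H K) (K := L)
    (s := Set.range (toHilbertTensor H K)) (t := Set.univ)
    (fun x _ => closure_mono Submodule.subset_span (denseRange_toHilbertTensor x))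
    (fun x _ => subset_closure (by simp))
  intro z
  refine closure_mono ?_ (h (x := z) trivial)
  change Submodule.span ℂ _ ≤ (LinearMap.range (tripleLeft (H := H) (K := K) (L := L)).toLinearMap)
  rw [Submodule.span_le]
  rintro _ ⟨_, ⟨x, rfl⟩, y, -, rfl⟩
  exact ⟨x ⊗ₜ[ℂ] y, rfl⟩

theorem denseRange_tripleRight :
    DenseRange (tripleRight : H ⊗[ℂ] (K ⊗[ℂ] L) →ₗᵢ[ℂ] HilbertTensor H (HilbertTensor K L)) := by
  have h := span_vecTensor_dense (H := H) (K := HilbertTensor K L)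
    (s := Set.univ) (t := Set.range (toHilbertTensor K L))
    (fun x _ => subset_closure (by simp))
    (fun x _ => closure_mono Submodule.subset_span (denseRange_toHilbertTensor x))
  intro z
  refine closure_mono ?_ (h (x := z) trivial)
  change Submodule.span ℂ _ ≤ (LinearMap.range (tripleRight (H := H) (K := K) (L := L)).toLinearMap)
  rw [Submodule.span_le]
  rintro _ ⟨x, -, _, ⟨y, rfl⟩, rfl⟩
  exact ⟨x ⊗ₜ[ℂ] y, rfl⟩

variable (H K L) in
/-- The canonical unitary `(H ⊗ K) ⊗ L ≃ H ⊗ (K ⊗ L)`. -/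
def hilbertAssoc :
    HilbertTensor (HilbertTensor H K) L ≃ₗᵢ[ℂ] HilbertTensor H (HilbertTensor K L) :=
  (TensorProduct.assoc ℂ H K L).extendOfIsometry
    (tripleLeft (H := H) (K := K) (L := L)).toLinearMap
    (tripleRight (H := H) (K := K) (L := L)).toLinearMap
    denseRange_tripleLeft denseRange_tripleRight
    (fun x => by
      have h1 := (tripleRight (H := H) (K := K) (L := L)).norm_map (TensorProduct.assoc ℂ H K L x)
      have h2 := (tripleLeft (H := H) (K := K) (L := L)).norm_map x
      exact h1.trans ((TensorProduct.norm_assoc x).trans h2.symm))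

theorem hilbertAssoc_vecTensor (x : H) (y : K) (z : L) :
    hilbertAssoc H K L (vecTensor (vecTensor x y) z) = vecTensor x (vecTensor y z) :=
  LinearEquiv.extendOfIsometry_eq (TensorProduct.assoc ℂ H K L)
    (tripleLeft (H := H) (K := K) (L := L)).toLinearMap
    (tripleRight (H := H) (K := K) (L := L)).toLinearMap
    denseRange_tripleLeft denseRange_tripleRight _ ((x ⊗ₜ[ℂ] y) ⊗ₜ[ℂ] z)

end General

/-! ### Minimal tensor products, compact quantum semigroups and compact quantum groups -/

section CStar

variable {H : Type u} {K : Type v}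
  [NormedAddCommGroup H] [InnerProductSpace ℂ H] [CompleteSpace H]
  [NormedAddCommGroup K] [InnerProductSpace ℂ K] [CompleteSpace K]

theorem star_opTensor (a : H →L[ℂ] H) (b : K →L[ℂ] K) :
    star (opTensor a b) = opTensor (star a) (star b) := by
  rw [ContinuousLinearMap.star_eq_adjoint, ContinuousLinearMap.star_eq_adjoint,
    ContinuousLinearMap.star_eq_adjoint]
  symm
  rw [ContinuousLinearMap.eq_adjoint_iff]
  intro z z'
  revert z'
  have key : ∀ x y z', ⟪opTensor a.adjoint b.adjoint (vecTensor x y), z'⟫_ℂ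
      = ⟪vecTensor x y, opTensor a b z'⟫_ℂ := by
    intro x y z'
    have : (innerSL ℂ (opTensor a.adjoint b.adjoint (vecTensor x y)))
        = (innerSL ℂ (vecTensor x y)).comp (opTensor a b) :=
      hilbertTensor_ext fun x' y' => by simp [ContinuousLinearMap.adjoint_inner_left]
    exact DFunLike.congr_fun this z'
  intro z'
  have h2 : (innerSL ℂ z').comp (opTensor a.adjoint b.adjoint) = innerSL ℂ (opTensor a b z') :=
    hilbertTensor_ext fun x y => by
      have := congrArg (starRingEnd ℂ) (key x y z')
      simpa only [inner_conj_symm, ContinuousLinearMap.comp_apply, innerSL_apply_apply] using this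
  have h3 := congrArg (starRingEnd ℂ) (DFunLike.congr_fun h2 z)
  simpa only [inner_conj_symm, ContinuousLinearMap.comp_apply, innerSL_apply_apply] using h3

/-- The minimal (spatial) C*-tensor product of two unital C*-algebras `A ⊆ B(H)`, `B ⊆ B(K)`:
the closed *-subalgebra of `B(H ⊗ K)` generated by the operators `a ⊗ b`. -/
def minTensor (A : StarSubalgebra ℂ (H →L[ℂ] H)) (B : StarSubalgebra ℂ (K →L[ℂ] K)) :
    StarSubalgebra ℂ (HilbertTensor H K →L[ℂ] HilbertTensor H K) :=
  (StarAlgebra.adjoin ℂ {x | ∃ a ∈ A, ∃ b ∈ B, x = opTensor a b}).topologicalClosure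

/-- The elementary tensor `a ⊗ b` as an element of the minimal tensor product. -/
def elemTensor {A : StarSubalgebra ℂ (H →L[ℂ] H)} {B : StarSubalgebra ℂ (K →L[ℂ] K)}
    (a : A) (b : B) : minTensor A B :=
  ⟨opTensor (a : H →L[ℂ] H) (b : K →L[ℂ] K),
    StarSubalgebra.le_topologicalClosure _
      (StarAlgebra.subset_adjoin ℂ _ ⟨a, a.2, b, b.2, rfl⟩)⟩

/-- Coassociativity `(Δ ⊗ id) Δ = (id ⊗ Δ) Δ`. Here `Φ` is `Δ ⊗ id` and `Ψ` is `id ⊗ Δ`: these are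
the *-homomorphisms on `A ⊗ A` with the indicated values on elementary tensors (they are unique,
since *-homomorphisms of C*-algebras are continuous), and `(A ⊗ A) ⊗ A` is identified with
`A ⊗ (A ⊗ A)` through the canonical unitary of the underlying Hilbert spaces. -/
def IsCoassociative (A : StarSubalgebra ℂ (H →L[ℂ] H)) (Δ : A →⋆ₐ[ℂ] minTensor A A) : Prop :=
  ∃ (Φ : minTensor A A →⋆ₐ[ℂ] minTensor (minTensor A A) A)
    (Ψ : minTensor A A →⋆ₐ[ℂ] minTensor A (minTensor A A)),
    (∀ a b : A, Φ (elemTensor a b) = elemTensor (Δ a) b) ∧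
    (∀ a b : A, Ψ (elemTensor a b) = elemTensor a (Δ b)) ∧
    ∀ a : A, (hilbertAssoc H H H).conjStarAlgEquiv
        (Φ (Δ a) : HilbertTensor (HilbertTensor H H) H →L[ℂ] HilbertTensor (HilbertTensor H H) H)
      = (Ψ (Δ a) : HilbertTensor H (HilbertTensor H H) →L[ℂ] HilbertTensor H (HilbertTensor H H))

/-- `(A, Δ)` is a compact quantum semigroup: `A` is a unital C*-algebra (given as a norm closed
unital *-subalgebra of `B(H)`), and `Δ : A → A ⊗ A` is a coassociative unital *-homomorphism into
the minimal tensor product. -/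
structure IsCompactQuantumSemigroup (A : StarSubalgebra ℂ (H →L[ℂ] H))
    (Δ : A →⋆ₐ[ℂ] minTensor A A) : Prop where
  isClosed : IsClosed (A : Set (H →L[ℂ] H))
  coassoc : IsCoassociative A Δ

/-- The linear span of `{(a ⊗ I) Δ(b) : a, b ∈ A}` in `A ⊗ A`. -/
def leftSpan {A : StarSubalgebra ℂ (H →L[ℂ] H)} (Δ : A →⋆ₐ[ℂ] minTensor A A) :
    Submodule ℂ (minTensor A A) :=
  Submodule.span ℂ {x | ∃ a b : A, x = elemTensor a 1 * Δ b}

/-- The linear span of `{(I ⊗ a) Δ(b) : a, b ∈ A}` in `A ⊗ A`. -/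
def rightSpan {A : StarSubalgebra ℂ (H →L[ℂ] H)} (Δ : A →⋆ₐ[ℂ] minTensor A A) :
    Submodule ℂ (minTensor A A) :=
  Submodule.span ℂ {x | ∃ a b : A, x = elemTensor 1 a * Δ b}

/-- `(A, Δ)` is a compact quantum group in the sense of Woronowicz: a compact quantum semigroup
such that the spans of `(a ⊗ I) Δ(b)` and of `(I ⊗ a) Δ(b)` are dense in `A ⊗ A`. -/
structure IsCompactQuantumGroup (A : StarSubalgebra ℂ (H →L[ℂ] H))
    (Δ : A →⋆ₐ[ℂ] minTensor A A) : Prop extends IsCompactQuantumSemigroup A Δ where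
  dense_left : Dense (leftSpan Δ : Set (minTensor A A))
  dense_right : Dense (rightSpan Δ : Set (minTensor A A))

end CStar

/-! ### The Toeplitz algebra -/

/-- The Hilbert space `ℓ²(ℤ₊)`. -/
abbrev EllTwo : Type := lp (fun _ : ℕ => ℂ) 2

/-- The standard basis vector `e_n`. -/
def stdVec (n : ℕ) : EllTwo := lp.single 2 n (1 : ℂ)

/-- The sequence `(0, f 0, f 1, …)`. -/
def shiftFun (f : ℕ → ℂ) : ℕ → ℂ
  | 0 => 0
  | n + 1 => f n

theorem hasSum_shiftFun (f : EllTwo) :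
    HasSum (fun n => ‖shiftFun f n‖ ^ (2 : ℝ)) (‖f‖ ^ (2 : ℝ)) := by
  have h : HasSum (fun n => ‖f n‖ ^ (2 : ℝ)) (‖f‖ ^ (2 : ℝ)) := by
    simpa using lp.hasSum_norm (p := 2) (by norm_num) f
  rw [← hasSum_nat_add_iff' 1]
  simpa [shiftFun] using h

/-- The right shift `T` on `ℓ²(ℤ₊)`, as an isometry. -/
def shiftIsometry : EllTwo →ₗᵢ[ℂ] EllTwo where
  toFun f := ⟨shiftFun f, memℓp_gen (by simpa using (hasSum_shiftFun f).summable)⟩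
  map_add' f g := by
    ext n
    change shiftFun (f + g) n = shiftFun f n + shiftFun g n
    cases n <;> simp [shiftFun]
  map_smul' c f := by
    ext n
    change shiftFun (c • f) n = c * shiftFun f n
    cases n <;> simp [shiftFun]
  norm_map' f := by
    set g : EllTwo :=
      ⟨shiftFun f, memℓp_gen (by simpa using (hasSum_shiftFun f).summable)⟩ with hg
    have h : HasSum (fun n => ‖g n‖ ^ (2 : ℝ)) (‖g‖ ^ (2 : ℝ)) := by
      simpa using lp.hasSum_norm (p := 2) (by norm_num) g
    exact (Real.rpow_left_inj (norm_nonneg _) (norm_nonneg _) (by norm_num : (2 : ℝ) ≠ 0)).1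
      (h.unique (hasSum_shiftFun f))

/-- The right shift `T` as a bounded operator. -/
def shift : EllTwo →L[ℂ] EllTwo := shiftIsometry.toContinuousLinearMap

theorem shift_e (n : ℕ) : shift (stdVec n) = stdVec (n + 1) := by
  ext m
  change shiftFun (stdVec n) m = stdVec (n + 1) m
  cases m <;> simp [shiftFun, stdVec, lp.single_apply, Pi.single_apply]

/-- The Toeplitz algebra: the norm closed subalgebra of `B(ℓ²(ℤ₊))` generated by `T` and `T*`. -/
def toeplitzAlgebra : StarSubalgebra ℂ (EllTwo →L[ℂ] EllTwo) :=
  (StarAlgebra.adjoin ℂ {shift}).topologicalClosure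

/-- The shift `T` as an element of the Toeplitz algebra. -/
def toeplitzShift : toeplitzAlgebra :=
  ⟨shift, StarSubalgebra.le_topologicalClosure _ (StarAlgebra.subset_adjoin ℂ _ rfl)⟩

/-- The operator `T_{n,m} = Tⁿ (T*)ᵐ` in the Toeplitz algebra. -/
def toeplitzMonomial (n m : ℕ) : toeplitzAlgebra :=
  toeplitzShift ^ n * star toeplitzShift ^ m

/-! ### The comultiplication

The comultiplication is the unique unital *-homomorphism with `Δ(T) = T ⊗ T`. For its existence,
`ℓ²(ℤ₊) ⊗ ℓ²(ℤ₊)` is decomposed into diagonals: `e_{n + d⁺} ⊗ e_{n + d⁻} ↔ e_n ⊗ f_d`, where `f_d`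
is the standard basis of `ℓ²(ℤ)`. Then `T ⊗ T` corresponds to `T ⊗ 1`. -/

theorem lp_single_orthonormal (ι : Type) [DecidableEq ι] :
    Orthonormal ℂ (fun i : ι => (lp.single 2 i (1 : ℂ) : lp (fun _ : ι => ℂ) 2)) := by
  rw [orthonormal_iff_ite]
  intro i j
  rw [lp.inner_single_left]
  by_cases h : i = j <;> simp [lp.single_apply, h]

theorem lp_single_dense (ι : Type) [DecidableEq ι] :
    ⊤ ≤ (Submodule.span ℂ (Set.range
      (fun i : ι => (lp.single 2 i (1 : ℂ) : lp (fun _ : ι => ℂ) 2)))).topologicalClosure := by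
  have h := (HilbertBasis.ofRepr (LinearIsometryEquiv.refl ℂ (lp (fun _ : ι => ℂ) 2))).dense_span
  rw [← h]
  refine Submodule.topologicalClosure_mono (Submodule.span_mono ?_)
  rintro _ ⟨i, rfl⟩
  refine ⟨i, ?_⟩
  rw [← HilbertBasis.repr_symm_single]
  rfl

/-- The standard basis vector `f_d` of `ℓ²(ℤ)`. -/
def fZ (d : ℤ) : lp (fun _ : ℤ => ℂ) 2 := lp.single 2 d (1 : ℂ)

/-- The Hilbert basis `e_n ⊗ f_d` of `ℓ²(ℤ₊) ⊗ ℓ²(ℤ)`. -/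
def basisNZ : HilbertBasis (ℕ × ℤ) ℂ (HilbertTensor EllTwo (lp (fun _ : ℤ => ℂ) 2)) :=
  HilbertBasis.mk (v := fun p => vecTensor (stdVec p.1) (fZ p.2))
    (by
      rw [orthonormal_iff_ite]
      rintro ⟨n, d⟩ ⟨n', d'⟩
      have h1 := orthonormal_iff_ite.1 (lp_single_orthonormal ℕ) n n'
      have h2 := orthonormal_iff_ite.1 (lp_single_orthonormal ℤ) d d'
      rw [inner_vecTensor, stdVec, stdVec, fZ, fZ, h1, h2]
      by_cases hn : n = n' <;> by_cases hd : d = d' <;> simp [hn, hd])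
    (by
      refine (span_vecTensor_dense (lp_single_dense ℕ) (lp_single_dense ℤ)).trans
        (Submodule.topologicalClosure_mono (Submodule.span_mono ?_))
      rintro _ ⟨_, ⟨n, rfl⟩, _, ⟨d, rfl⟩, rfl⟩
      exact ⟨(n, d), rfl⟩)

/-- The Hilbert basis `e_{n + d⁺} ⊗ e_{n + d⁻}` of `ℓ²(ℤ₊) ⊗ ℓ²(ℤ₊)`. -/
def basisDiag : HilbertBasis (ℕ × ℤ) ℂ (HilbertTensor EllTwo EllTwo) :=
  HilbertBasis.mk
    (v := fun p => vecTensor (stdVec (p.1 + p.2.toNat)) (stdVec (p.1 + (-p.2).toNat)))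
    (by
      rw [orthonormal_iff_ite]
      rintro ⟨n, d⟩ ⟨n', d'⟩
      have h1 := orthonormal_iff_ite.1 (lp_single_orthonormal ℕ) (n + d.toNat) (n' + d'.toNat)
      have h2 := orthonormal_iff_ite.1 (lp_single_orthonormal ℕ)
        (n + (-d).toNat) (n' + (-d').toNat)
      rw [inner_vecTensor, stdVec, stdVec, stdVec, stdVec, h1, h2]
      by_cases hp : (n, d) = (n', d')
      · obtain ⟨rfl, rfl⟩ := Prod.mk.inj hp
        simp
      · rw [if_neg hp]
        by_cases ha : n + d.toNat = n' + d'.toNat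
        · by_cases hb : n + (-d).toNat = n' + (-d').toNat
          · refine absurd (Prod.ext ?_ ?_) hp <;> simp only <;> omega
          · simp [hb]
        · simp [ha])
    (by
      refine (span_vecTensor_dense (lp_single_dense ℕ) (lp_single_dense ℕ)).trans
        (Submodule.topologicalClosure_mono (Submodule.span_mono ?_))
      rintro _ ⟨_, ⟨i, rfl⟩, _, ⟨j, rfl⟩, rfl⟩
      refine ⟨(min i j, (i : ℤ) - j), ?_⟩
      have h1 : min i j + ((i : ℤ) - j).toNat = i := by omega
      have h2 : min i j + (-((i : ℤ) - j)).toNat = j := by omega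
      simp only [h1, h2]
      rfl)

/-- The unitary `ℓ²(ℤ₊) ⊗ ℓ²(ℤ) → ℓ²(ℤ₊) ⊗ ℓ²(ℤ₊)`, `e_n ⊗ f_d ↦ e_{n + d⁺} ⊗ e_{n + d⁻}`. -/
def diagUnitary :
    HilbertTensor EllTwo (lp (fun _ : ℤ => ℂ) 2) ≃ₗᵢ[ℂ] HilbertTensor EllTwo EllTwo :=
  basisNZ.repr.trans basisDiag.repr.symm

theorem diagUnitary_apply (n : ℕ) (d : ℤ) :
    diagUnitary (vecTensor (stdVec n) (fZ d)) = vecTensor (stdVec (n + d.toNat)) (stdVec (n + (-d).toNat)) := by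
  have h1 : basisNZ (n, d) = vecTensor (stdVec n) (fZ d) := by
    rw [basisNZ, HilbertBasis.coe_mk]
  have h2 : basisDiag (n, d) = vecTensor (stdVec (n + d.toNat)) (stdVec (n + (-d).toNat)) := by
    rw [basisDiag, HilbertBasis.coe_mk]
  rw [← h1, ← h2, diagUnitary, LinearIsometryEquiv.trans_apply, HilbertBasis.repr_self,
    HilbertBasis.repr_symm_single]

/-- The *-homomorphism `a ↦ a ⊗ 1`. -/
def ampliation : (EllTwo →L[ℂ] EllTwo) →⋆ₐ[ℂ]
    (HilbertTensor EllTwo (lp (fun _ : ℤ => ℂ) 2) →L[ℂ]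
      HilbertTensor EllTwo (lp (fun _ : ℤ => ℂ) 2)) where
  toFun a := opTensor a 1
  map_one' := opTensor_one
  map_mul' a b := by rw [← opTensor_mul, one_mul]
  map_zero' := by
    have h := opTensor_smul_left (0 : ℂ) (0 : EllTwo →L[ℂ] EllTwo)
      (1 : lp (fun _ : ℤ => ℂ) 2 →L[ℂ] lp (fun _ : ℤ => ℂ) 2)
    rwa [zero_smul, zero_smul] at h
  map_add' a b := opTensor_add_left a b 1
  commutes' c := by
    rw [Algebra.algebraMap_eq_smul_one, Algebra.algebraMap_eq_smul_one, opTensor_smul_left,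
      opTensor_one]
  map_star' a := by rw [star_opTensor, star_one]

/-- The comultiplication, as a *-homomorphism on all of `B(ℓ²(ℤ₊))`. -/
def bigComul : (EllTwo →L[ℂ] EllTwo) →⋆ₐ[ℂ]
    (HilbertTensor EllTwo EllTwo →L[ℂ] HilbertTensor EllTwo EllTwo) where
  toFun a := diagUnitary.conjStarAlgEquiv (ampliation a)
  map_one' := by rw [map_one, map_one]
  map_mul' a b := by rw [map_mul, map_mul]
  map_zero' := by rw [map_zero, map_zero]
  map_add' a b := by rw [map_add, map_add]
  commutes' c := by
    rw [Algebra.algebraMap_eq_smul_one, Algebra.algebraMap_eq_smul_one, map_smul, map_smul,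
      map_one, map_one]
  map_star' a := by rw [map_star, map_star]

theorem bigComul_shift : bigComul shift = opTensor shift shift := by
  refine ContinuousLinearMap.ext_on
    (Submodule.dense_iff_topologicalClosure_eq_top.2 basisDiag.dense_span) ?_
  rintro _ ⟨⟨n, d⟩, rfl⟩
  have h2 : basisDiag (n, d) = vecTensor (stdVec (n + d.toNat)) (stdVec (n + (-d).toNat)) := by
    rw [basisDiag, HilbertBasis.coe_mk]
  have h3 : bigComul shift (diagUnitary (vecTensor (stdVec n) (fZ d)))
      = diagUnitary (vecTensor (stdVec (n + 1)) (fZ d)) := by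
    change diagUnitary (opTensor shift 1
      (diagUnitary.symm (diagUnitary (vecTensor (stdVec n) (fZ d))))) = _
    rw [LinearIsometryEquiv.symm_apply_apply, opTensor_vecTensor, shift_e]
    rfl
  rw [h2, ← diagUnitary_apply, h3, diagUnitary_apply, diagUnitary_apply, opTensor_vecTensor,
    shift_e, shift_e, add_right_comm, add_right_comm n 1]

theorem continuous_starAlgHom {A B : Type*} [CStarAlgebra A] [CStarAlgebra B] (φ : A →⋆ₐ[ℂ] B) :
    Continuous φ :=
  AddMonoidHomClass.continuous_of_bound φ 1 fun x => by
    simpa using NonUnitalStarAlgHom.norm_apply_le φ x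

theorem continuous_bigComul : Continuous bigComul := by
  exact continuous_starAlgHom bigComul

theorem bigComul_mem {a : EllTwo →L[ℂ] EllTwo} (ha : a ∈ toeplitzAlgebra) :
    bigComul a ∈ minTensor toeplitzAlgebra toeplitzAlgebra := by
  have hcl : IsClosed (minTensor toeplitzAlgebra toeplitzAlgebra :
      Set (HilbertTensor EllTwo EllTwo →L[ℂ] HilbertTensor EllTwo EllTwo)) :=
    StarSubalgebra.isClosed_topologicalClosure _
  have h : toeplitzAlgebra ≤ (minTensor toeplitzAlgebra toeplitzAlgebra).comap bigComul := by
    refine StarSubalgebra.topologicalClosure_minimal (StarAlgebra.adjoin_le ?_)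
      (hcl.preimage continuous_bigComul)
    rintro _ rfl
    change bigComul shift ∈ minTensor toeplitzAlgebra toeplitzAlgebra
    rw [bigComul_shift]
    exact (elemTensor toeplitzShift toeplitzShift).2
  exact h ha

theorem existsUnique_comul :
    ∃! Δ : toeplitzAlgebra →⋆ₐ[ℂ] minTensor toeplitzAlgebra toeplitzAlgebra,
      Δ toeplitzShift = elemTensor toeplitzShift toeplitzShift := by
  refine ⟨StarAlgHom.codRestrict (bigComul.comp toeplitzAlgebra.subtype)
    (minTensor toeplitzAlgebra toeplitzAlgebra) fun a => bigComul_mem a.2,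
    Subtype.ext bigComul_shift, ?_⟩
  intro Δ hΔ
  have : IsClosed (toeplitzAlgebra : Set (EllTwo →L[ℂ] EllTwo)) :=
    StarSubalgebra.isClosed_topologicalClosure _
  have : IsClosed (minTensor toeplitzAlgebra toeplitzAlgebra :
      Set (HilbertTensor EllTwo EllTwo →L[ℂ] HilbertTensor EllTwo EllTwo)) :=
    StarSubalgebra.isClosed_topologicalClosure _
  have h1 : Continuous Δ :=
    continuous_starAlgHom (A := toeplitzAlgebra)
      (B := minTensor toeplitzAlgebra toeplitzAlgebra) Δ
  have h2 : Continuous (StarAlgHom.codRestrict (bigComul.comp toeplitzAlgebra.subtype)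
      (minTensor toeplitzAlgebra toeplitzAlgebra) fun a => bigComul_mem a.2) :=
    (continuous_bigComul.comp continuous_subtype_val).subtype_mk _
  refine StarAlgebra.elemental.starAlgHomClass_ext ℂ (a := shift) h1 h2 ?_
  exact hΔ.trans (Subtype.ext bigComul_shift.symm)

/-- The comultiplication `Δ : 𝒯 → 𝒯 ⊗ 𝒯`: the unique unital *-homomorphism with
`Δ(T) = T ⊗ T`. -/
def toeplitzComul : toeplitzAlgebra →⋆ₐ[ℂ] minTensor toeplitzAlgebra toeplitzAlgebra :=
  existsUnique_comul.choose

theorem toeplitzComul_shift :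
    toeplitzComul toeplitzShift = elemTensor toeplitzShift toeplitzShift :=
  existsUnique_comul.choose_spec.1

end ToeplitzCQS

end

open ToeplitzCQS

namespace ToeplitzCQS

/-! The operator T ⊗ T preserves each diagonal of basis vectors e_i ⊗ e_j with i - j fixed, and so
does every Δ(b): the unitary `diagUnitary` turns Δ(b) into b ⊗ 1 on ℓ²(ℤ₊) ⊗ ℓ²(ℤ), where the
ℤ-coordinate records the diagonal. The vector e_0 ⊗ e_1 is the first one on the diagonal -1, so
Δ(b)(e_0 ⊗ e_1) lies in the closed span of the vectors e_n ⊗ e_{n+1}. The second index there is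
never 0, hence the result is orthogonal to x ⊗ e_0 for every x
(`inner_vecTensor_zero_toeplitzComul`).

Multiplying on the left by a ⊗ I does not touch the second factor, so the orthogonality persists on
all of the left span (`inner_vecTensor_zero_leftSpan`), and it passes to closures. But T ⊗ T* lowers
the second index and sends e_0 ⊗ e_1 to e_1 ⊗ e_0, a unit vector of the excluded form. This gives
the vector statement, from which the others follow. -/

theorem inner_stdVec (i j : ℕ) : ⟪stdVec i, stdVec j⟫_ℂ = if i = j then 1 else 0 :=
  orthonormal_iff_ite.1 (lp_single_orthonormal ℕ) i j

theorem inner_shift_shift (x y : EllTwo) : ⟪shift x, shift y⟫_ℂ = ⟪x, y⟫_ℂ :=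
  shiftIsometry.inner_map_map x y

theorem star_shift_stdVec_succ (n : ℕ) : star shift (stdVec (n + 1)) = stdVec n := by
  refine ext_inner_left ℂ fun x => ?_
  rw [ContinuousLinearMap.star_eq_adjoint, ContinuousLinearMap.adjoint_inner_right, ← shift_e,
    inner_shift_shift]

/-! ### The comultiplication on diagonals -/

/-- The comultiplication of the Toeplitz algebra is the restriction of `bigComul`. -/
theorem coe_toeplitzComul (b : toeplitzAlgebra) :
    (toeplitzComul b : HilbertTensor EllTwo EllTwo →L[ℂ] HilbertTensor EllTwo EllTwo)
      = bigComul b := by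
  -- `toeplitzComul` is known only through its value on T, so uniqueness is what identifies it with
  -- the explicit model.
  have h : toeplitzComul = StarAlgHom.codRestrict (bigComul.comp toeplitzAlgebra.subtype)
      (minTensor toeplitzAlgebra toeplitzAlgebra) fun a => bigComul_mem a.2 :=
    existsUnique_comul.unique toeplitzComul_shift (Subtype.ext bigComul_shift)
  rw [h]
  rfl

/-- Conjugating back by the unitary leaves b ⊗ 1, which acts on the first factor only; the diagonal,
encoded in `z`, is therefore preserved. -/
theorem bigComul_diagUnitary (b : EllTwo →L[ℂ] EllTwo) (y : EllTwo)
    (z : lp (fun _ : ℤ => ℂ) 2) :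
    bigComul b (diagUnitary (vecTensor y z)) = diagUnitary (vecTensor (b y) z) := by
  change diagUnitary (opTensor b 1 (diagUnitary.symm (diagUnitary (vecTensor y z)))) = _
  rw [LinearIsometryEquiv.symm_apply_apply, opTensor_vecTensor]
  rfl

/-- The range of `y ↦ U (y ⊗ f₋₁)` is spanned by the vectors `e_n ⊗ e_{n+1}`, hence is orthogonal
to `x ⊗ e_0`. -/
theorem inner_vecTensor_zero_diagUnitary (x y : EllTwo) :
    ⟪vecTensor x (stdVec 0), diagUnitary (vecTensor y (fZ (-1)))⟫_ℂ = 0 := by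
  -- The condition is linear and closed in `y`, so it suffices to check it on basis vectors.
  have hc : Continuous fun y : EllTwo =>
      ⟪vecTensor x (stdVec 0), diagUnitary (vecTensor y (fZ (-1)))⟫_ℂ :=
    continuous_const.inner
      (diagUnitary.continuous.comp (continuous_vecTensor.comp (Continuous.prodMk_left (fZ (-1)))))
  have hy : y ∈ closure (Submodule.span ℂ
      (Set.range (fun i : ℕ => (lp.single 2 i (1 : ℂ) : EllTwo))) : Set EllTwo) :=
    lp_single_dense ℕ trivial
  refine closure_minimal (t := {y : EllTwo |
    ⟪vecTensor x (stdVec 0), diagUnitary (vecTensor y (fZ (-1)))⟫_ℂ = 0})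
    (fun y hy => ?_) (isClosed_singleton.preimage hc) hy
  change ⟪vecTensor x (stdVec 0), diagUnitary (vecTensor y (fZ (-1)))⟫_ℂ = 0
  induction hy using Submodule.span_induction with
  | mem y hy =>
    obtain ⟨n, rfl⟩ := hy
    change ⟪vecTensor x (stdVec 0), diagUnitary (vecTensor (stdVec n) (fZ (-1)))⟫_ℂ = 0
    -- For d = -1 the second index is n + 1, so the second factor of the inner product vanishes
    -- whatever `x` is.
    rw [diagUnitary_apply, inner_vecTensor, inner_stdVec, if_neg (by simp), mul_zero]
  | zero =>
    have h : vecTensor (0 : EllTwo) (fZ (-1)) = 0 := by simp [vecTensor]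
    rw [h, map_zero, inner_zero_right]
  | add a b _ _ ha hb => rw [vecTensor_add_left, map_add, inner_add_right, ha, hb, add_zero]
  | smul c a _ ha => rw [vecTensor_smul_left, map_smul, inner_smul_right, ha, mul_zero]

/-- Having `x` arbitrary is essential: it is what later absorbs the factor a ⊗ I. -/
theorem inner_vecTensor_zero_toeplitzComul (x : EllTwo) (b : toeplitzAlgebra) :
    ⟪vecTensor x (stdVec 0), (toeplitzComul b).1 (vecTensor (stdVec 0) (stdVec 1))⟫_ℂ = 0 := by
  -- The point n = 0, d = -1 of the diagonal basis: d⁺ = 0 and d⁻ = 1.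
  have h : diagUnitary (vecTensor (stdVec 0) (fZ (-1))) = vecTensor (stdVec 0) (stdVec 1) :=
    diagUnitary_apply 0 (-1)
  rw [coe_toeplitzComul, ← h, bigComul_diagUnitary, inner_vecTensor_zero_diagUnitary]

/-! ### The obstruction on the left span -/

theorem inner_vecTensor_zero_leftSpan (x : EllTwo)
    {B : minTensor toeplitzAlgebra toeplitzAlgebra} (hB : B ∈ leftSpan toeplitzComul) :
    ⟪vecTensor x (stdVec 0), B.1 (vecTensor (stdVec 0) (stdVec 1))⟫_ℂ = 0 := by
  induction hB using Submodule.span_induction with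
  | mem B hB =>
    obtain ⟨a, b, rfl⟩ := hB
    change ⟪vecTensor x (stdVec 0), opTensor (a : EllTwo →L[ℂ] EllTwo) 1
      ((toeplitzComul b).1 (vecTensor (stdVec 0) (stdVec 1)))⟫_ℂ = 0
    -- Moved to the other side, a ⊗ 1 becomes a* ⊗ 1, which only replaces x by a*x and keeps e_0.
    rw [← ContinuousLinearMap.adjoint_inner_left, ← ContinuousLinearMap.star_eq_adjoint,
      star_opTensor, star_one, opTensor_vecTensor]
    exact inner_vecTensor_zero_toeplitzComul _ b
  | zero => exact inner_zero_right _
  | add A B _ _ hA hB =>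
    change ⟪vecTensor x (stdVec 0), A.1 (vecTensor (stdVec 0) (stdVec 1))
      + B.1 (vecTensor (stdVec 0) (stdVec 1))⟫_ℂ = 0
    rw [inner_add_right, hA, hB, add_zero]
  | smul c A _ hA =>
    change ⟪vecTensor x (stdVec 0), c • A.1 (vecTensor (stdVec 0) (stdVec 1))⟫_ℂ = 0
    rw [inner_smul_right, hA, mul_zero]

theorem elemTensor_toeplitzMonomial_apply :
    (elemTensor (toeplitzMonomial 1 0) (toeplitzMonomial 0 1)).1
      (vecTensor (stdVec 0) (stdVec 1)) = vecTensor (stdVec 1) (stdVec 0) := by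
  have h1 : toeplitzMonomial 1 0 = toeplitzShift := by simp [toeplitzMonomial]
  have h2 : toeplitzMonomial 0 1 = star toeplitzShift := by simp [toeplitzMonomial]
  rw [h1, h2]
  change opTensor shift (star shift) (vecTensor (stdVec 0) (stdVec 1)) = _
  rw [opTensor_vecTensor, shift_e, star_shift_stdVec_succ]

theorem elemTensor_apply_notMem_closure_image_leftSpan :
    (elemTensor (toeplitzMonomial 1 0) (toeplitzMonomial 0 1)).1
        (vecTensor (stdVec 0) (stdVec 1)) ∉
      closure ((fun B : minTensor toeplitzAlgebra toeplitzAlgebra =>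
          B.1 (vecTensor (stdVec 0) (stdVec 1))) ''
        (leftSpan toeplitzComul : Set (minTensor toeplitzAlgebra toeplitzAlgebra))) := by
  rw [elemTensor_toeplitzMonomial_apply]
  intro h
  have hc : Continuous fun v : HilbertTensor EllTwo EllTwo =>
      ⟪vecTensor (stdVec 1) (stdVec 0), v⟫_ℂ := continuous_const.inner continuous_id
  -- Taking x = e_1 in the orthogonality relation, which is closed, makes e_1 ⊗ e_0 orthogonal to
  -- itself, although its norm is 1.
  have h0 : ⟪vecTensor (stdVec 1) (stdVec 0), vecTensor (stdVec 1) (stdVec 0)⟫_ℂ = 0 := by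
    refine closure_minimal (t := {v : HilbertTensor EllTwo EllTwo |
      ⟪vecTensor (stdVec 1) (stdVec 0), v⟫_ℂ = 0}) ?_ (isClosed_singleton.preimage hc) h
    rintro _ ⟨B, hB, rfl⟩
    exact inner_vecTensor_zero_leftSpan _ hB
  rw [inner_vecTensor, inner_stdVec, inner_stdVec] at h0
  simp at h0

end ToeplitzCQS

theorem theorem5 :
    ¬ IsCompactQuantumGroup toeplitzAlgebra toeplitzComul ∧
    ¬ Dense (leftSpan toeplitzComul : Set (minTensor toeplitzAlgebra toeplitzAlgebra)) ∧
    elemTensor (toeplitzMonomial 1 0) (toeplitzMonomial 0 1) ∉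
      closure (leftSpan toeplitzComul : Set (minTensor toeplitzAlgebra toeplitzAlgebra)) ∧
    (elemTensor (toeplitzMonomial 1 0) (toeplitzMonomial 0 1)).1
        (vecTensor (stdVec 0) (stdVec 1)) ∉
      closure ((fun B : minTensor toeplitzAlgebra toeplitzAlgebra =>
          B.1 (vecTensor (stdVec 0) (stdVec 1))) ''
        (leftSpan toeplitzComul : Set (minTensor toeplitzAlgebra toeplitzAlgebra))) := by
  -- Evaluation at e_0 ⊗ e_1 is norm continuous, so membership in the norm closure of the span would
  -- contradict the vector statement.
  have hc : Continuous fun B : minTensor toeplitzAlgebra toeplitzAlgebra =>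
      B.1 (vecTensor (stdVec 0) (stdVec 1)) :=
    (ContinuousLinearMap.apply ℂ (HilbertTensor EllTwo EllTwo)
      (vecTensor (stdVec 0) (stdVec 1))).continuous.comp continuous_subtype_val
  have hmem : elemTensor (toeplitzMonomial 1 0) (toeplitzMonomial 0 1) ∉
      closure (leftSpan toeplitzComul : Set (minTensor toeplitzAlgebra toeplitzAlgebra)) :=
    fun h => elemTensor_apply_notMem_closure_image_leftSpan
      (image_closure_subset_closure_image hc ⟨_, h, rfl⟩)
  exact ⟨fun h => hmem (h.dense_left _), fun h => hmem (h _), hmem,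
    elemTensor_apply_notMem_closure_image_leftSpan⟩
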